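/- Let $S=\mathbb{C}[x,y,z]$ and let $C: f=0$ be a reduced curve of degree $d\ge 3$ in $\mathbb{P}^2$, with Jacobian ideal $J_f=(f_x,f_y,f_z)$, Milnor algebra $M(f)=S/J_f$ and module of Jacobian syzygies $D_0(f)=\{(a,b,c)\in S^3 : af_x+bf_y+cf_z=0\}$. The curve $C$ is said to be of type $(d,r,m)$ if $D_0(f)$ is minimally generated by $m$ homogeneous syzygies, all of the same degree $r$. The total Tjurina number $\tau(C)$ is the degree of $J_f$, i.e. the constant value of $\dim_{\mathbb{C}} M(f)_k$ for $k\gg 0$. Let $C$ be a curve of type $(d,r,m)$ with $m>3$ and $\Delta m := 2r-d+3-m = 1$. Then $M(f)$ has a minimal graded free resolution of the form $$0\to \bigoplus_{i=1}^{m-2} S(-e_i)\to \bigoplus_{j=1}^{m} S(1-d-d_j)\to S^3(1-d)\to S,$$ where $e_1\le\dots\le e_{m-2}$ and $d_1=\dots=d_m=r$, and where the last map is $(a,b,c)\mapsto af_x+bf_y+cf_z$. In every such minimal resolution, the integers $\epsilon_j$ defined by $e_j=d+d_{j+2}-1+\epsilon_j$ for $1\le j\le m-2$ satisfy $\epsilon_{m-2}=2$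 and $\epsilon_j=1$ for $1\le j\le m-3$. Moreover, $$\tau(C)=\frac{d(d-1)}{2}-1+r(d-r-2).$$ -/

import Mathlib

namespace PlaneCurve

/-- The polynomial ring `S = ℂ[x, y, z]`. -/
abbrev S : Type := MvPolynomial (Fin 3) ℂ

/-- The Jacobian ideal `J_f = (f_x, f_y, f_z)`. -/
noncomputable def jacobianIdeal (f : S) : Ideal S :=
  Ideal.span (Set.range fun i : Fin 3 => MvPolynomial.pderiv i f)

/-- The Milnor (Jacobian) algebra `M(f) = S / J_f`. -/
abbrev MilnorAlgebra (f : S) : Type := S ⧸ jacobianIdeal f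

/-- The homogeneous component `M(f)_k`: the classes of the forms of degree `k`. -/
noncomputable def milnorComponent (f : S) (k : ℕ) : Submodule ℂ (MilnorAlgebra f) :=
  (MvPolynomial.homogeneousSubmodule (Fin 3) ℂ k).map
    (Ideal.Quotient.mkₐ ℂ (jacobianIdeal f)).toLinearMap

/-- `τ` is the total Tjurina number of the reduced curve `f = 0`, that is, the degree of its
Jacobian ideal: the Hilbert polynomial of `S / J_f` is the constant `τ`. -/
def IsTotalTjurinaNumber (f : S) (τ : ℕ) : Prop :=
  ∀ᶠ k : ℕ in Filter.atTop, Module.finrank ℂ (milnorComponent f k) = τ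

/-- The total Tjurina number is unique. -/
theorem IsTotalTjurinaNumber.unique {f : S} {τ τ' : ℕ}
    (h : IsTotalTjurinaNumber f τ) (h' : IsTotalTjurinaNumber f τ') : τ = τ' := by
  obtain ⟨k, hk, hk'⟩ := (Filter.Eventually.and h h').exists
  exact hk.symm.trans hk'

/-- The map `S³ → S`, `(a, b, c) ↦ a f_x + b f_y + c f_z`. -/
noncomputable def gradientMap (f : S) : (Fin 3 → S) →ₗ[S] S :=
  Fintype.linearCombination S fun i : Fin 3 => MvPolynomial.pderiv i f

theorem gradientMap_apply (f : S) (ρ : Fin 3 → S) :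
    gradientMap f ρ = ρ 0 * MvPolynomial.pderiv 0 f + ρ 1 * MvPolynomial.pderiv 1 f
      + ρ 2 * MvPolynomial.pderiv 2 f := by
  simp [gradientMap, Fintype.linearCombination_apply, Fin.sum_univ_three]

/-- The cokernel of `gradientMap f` is `M(f)`. -/
theorem range_gradientMap (f : S) : LinearMap.range (gradientMap f) = jacobianIdeal f := by
  simp [gradientMap, jacobianIdeal, Fintype.range_linearCombination, Ideal.span]

/-- The module `D₀(f)` of Jacobian syzygies of `f`. -/
noncomputable def jacobianSyzygies (f : S) : Submodule S (Fin 3 → S) :=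
  LinearMap.ker (gradientMap f)

/-- `ρ 0, …, ρ (m - 1)` is a minimal set of homogeneous generators of `D₀(f)`, and `ρ j` is of
degree `deg j`. -/
structure IsMinimalGenerators (f : S) {m : ℕ} (deg : Fin m → ℕ) (ρ : Fin m → Fin 3 → S) :
    Prop where
  homogeneous : ∀ j i, (ρ j i).IsHomogeneous (deg j)
  span_eq : Submodule.span S (Set.range ρ) = jacobianSyzygies f
  minimal : ∀ j, ρ j ∉ Submodule.span S (ρ '' {j}ᶜ)

/-- `f = 0` is a curve of type `(d, r, m)`: a reduced curve of degree `d ≥ 3` in `ℙ²` such that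
`D₀(f)` is minimally generated by `m` homogeneous syzygies, all of the same degree `r`. -/
structure IsCurveOfType (f : S) (d r m : ℕ) : Prop where
  three_le : 3 ≤ d
  homogeneous : f.IsHomogeneous d
  reduced : Squarefree f
  generators : ∃ ρ : Fin m → Fin 3 → S, IsMinimalGenerators f (fun _ => r) ρ

/-- `v` is a homogeneous element of degree `n` of the graded free module `⊕ᵢ S(-a i)`. -/
def IsHomogeneousVec {ι : Type} (a : ι → ℕ) (n : ℕ) (v : ι → S) : Prop :=
  ∀ i, (a i ≤ n ∧ (v i).IsHomogeneous (n - a i)) ∨ v i = 0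

/-- `φ : ⊕ⱼ S(-b j) → ⊕ᵢ S(-a i)` is homogeneous of degree zero. -/
def IsGradedMap {ι κ : Type} [DecidableEq κ] (b : κ → ℕ) (a : ι → ℕ)
    (φ : (κ → S) →ₗ[S] (ι → S)) : Prop :=
  ∀ j, IsHomogeneousVec a (b j) (φ (Pi.single j 1))

/-- All entries of the matrix of `φ` lie in the ideal `(x, y, z)`. -/
def IsMinimalMap {ι κ : Type} [DecidableEq κ] (φ : (κ → S) →ₗ[S] (ι → S)) : Prop :=
  ∀ j i, MvPolynomial.constantCoeff (φ (Pi.single j 1) i) = 0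

/-- A minimal graded free resolution of the Milnor algebra of the form `f` of degree `d`,
`0 → ⊕ᵢ S(-eᵢ) → ⊕ⱼ S(1 - d - dⱼ) → S³(1 - d) → S`,
where `j` runs over `k + 2` and `i` over `k` indices, `d₁ ≤ d₂ ≤ …` and `e₁ ≤ e₂ ≤ …`
(indices start at `0` below), and the last map is `(a, b, c) ↦ a f_x + b f_y + c f_z`. -/
structure MinimalResolution (f : S) (d : ℕ) where
  k : ℕ
  deg : Fin (k + 2) → ℕ
  e : Fin k → ℕ
  deg_mono : Monotone deg
  e_mono : Monotone e
  φ₂ : (Fin (k + 2) → S) →ₗ[S] (Fin 3 → S)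
  φ₃ : (Fin k → S) →ₗ[S] (Fin (k + 2) → S)
  graded₂ : IsGradedMap (fun j => d - 1 + deg j) (fun _ => d - 1) φ₂
  graded₃ : IsGradedMap e (fun j => d - 1 + deg j) φ₃
  exact₁ : Function.Exact φ₂ (gradientMap f)
  exact₂ : Function.Exact φ₃ φ₂
  injective₃ : Function.Injective φ₃
  minimal₁ : ∀ i, MvPolynomial.constantCoeff (MvPolynomial.pderiv i f) = 0
  minimal₂ : IsMinimalMap φ₂
  minimal₃ : IsMinimalMap φ₃

/-- The integers `ε_j` given by `e_j = d + d_{j+2} - 1 + ε_j`. -/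
def MinimalResolution.ε {f : S} {d : ℕ} (R : MinimalResolution f d) (j : Fin R.k) : ℤ :=
  (R.e j : ℤ) - ((d : ℤ) + (R.deg (j.natAdd 2 |>.cast (Nat.add_comm 2 R.k)) : ℤ) - 1)

end PlaneCurve

/-!
The depth lemma, applied to the exact sequence at two successive maps, shows that `x, y, z` is a
regular sequence on the image of a minimal map onto the relations among the syzygies of the partial
derivatives. The kernel `K` of that map is therefore contained in `𝔪 K`, so `K = 0` and the
resolution stops there. Tensoring with `ℂ = S / 𝔪` shows that the number and degrees of minimal
generators are unique, so every minimal resolution has the degrees `r` of the given syzygies.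

Read off the resolution, the Hilbert function of `M(f)` is eventually `A (n + 3/2) + B/2`, with
`A` linear in the twists and `B` a combination of their squares. As `f` is reduced, no irreducible
polynomial divides all three partial derivatives; hence one of them is coprime to a generic
combination of the other two, and Bézout bounds the Hilbert function by `(d - 1)²`. Thus `A = 0`,
which says that `∑ (ε j - 1) = Δm = 1`. Minimality forces `ε j ≥ 1`, and as `ε` is monotone it is
`1, …, 1, 2`; then `B/2` is the Tjurina number.
-/

namespace PlaneCurve

open MvPolynomial RingTheory.Sequence

section GradedFreeModules

variable {σ R ι κ : Type*} [CommRing R]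

section

attribute [local instance] MvPolynomial.gradedAlgebra

theorem homogeneousComponent_mul_of_isHomogeneous (p : MvPolynomial σ R) {h : MvPolynomial σ R}
    {k : ℕ} (hh : h.IsHomogeneous k) (n : ℕ) :
    homogeneousComponent n (p * h) =
      if k ≤ n then homogeneousComponent (n - k) p * h else 0 := by
  simp only [← decomposition.decompose'_apply]
  exact DirectSum.coe_decompose_mul_of_right_mem (homogeneousSubmodule σ R) n hh

end

/-- The component of degree `n` of the graded free module `⊕ᵢ P(-a i)` over `P = R[σ]`. -/
noncomputable def homogeneousPart (σ R : Type*) [CommRing R] {ι : Type*} (a : ι → ℕ) (n : ℕ) :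
    Submodule R (ι → MvPolynomial σ R) :=
  Submodule.pi Set.univ fun i => if a i ≤ n then homogeneousSubmodule σ R (n - a i) else ⊥

/-- The projection of the graded free module `⊕ᵢ P(-a i)` over `P = R[σ]` onto its component of
degree `n`. -/
noncomputable def homogeneousProj (σ R : Type*) [CommRing R] {ι : Type*} (a : ι → ℕ) (n : ℕ) :
    (ι → MvPolynomial σ R) →ₗ[R] (ι → MvPolynomial σ R) :=
  LinearMap.pi fun i =>
    (if a i ≤ n then homogeneousComponent (n - a i) else 0) ∘ₗ LinearMap.proj i

theorem mem_homogeneousPart {a : ι → ℕ} {n : ℕ} {v : ι → MvPolynomial σ R} :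
    v ∈ homogeneousPart σ R a n ↔
      ∀ i, (a i ≤ n ∧ (v i).IsHomogeneous (n - a i)) ∨ v i = 0 := by
  simp only [homogeneousPart, Submodule.mem_pi, Set.mem_univ, true_implies]
  refine forall_congr' fun i => ?_
  split_ifs with h
  · simp only [mem_homogeneousSubmodule, h, true_and]
    exact ⟨Or.inl, fun h' => h'.elim id fun h0 => h0 ▸ isHomogeneous_zero _ _ _⟩
  · simp [h]

theorem homogeneousProj_apply (a : ι → ℕ) (n : ℕ) (v : ι → MvPolynomial σ R) (i : ι) :
    homogeneousProj σ R a n v i = if a i ≤ n then homogeneousComponent (n - a i) (v i) else 0 := by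
  simp only [homogeneousProj, LinearMap.pi_apply, LinearMap.comp_apply, LinearMap.proj_apply]
  split_ifs <;> rfl

theorem homogeneousProj_mem (a : ι → ℕ) (n : ℕ) (v : ι → MvPolynomial σ R) :
    homogeneousProj σ R a n v ∈ homogeneousPart σ R a n := mem_homogeneousPart.mpr fun i => by
  rw [homogeneousProj_apply]
  split_ifs with h
  · exact Or.inl ⟨h, homogeneousComponent_isHomogeneous _ _⟩
  · exact Or.inr rfl

theorem homogeneousProj_of_mem {a : ι → ℕ} {n : ℕ} {v : ι → MvPolynomial σ R}
    (hv : v ∈ homogeneousPart σ R a n) : homogeneousProj σ R a n v = v := by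
  funext i
  rw [homogeneousProj_apply]
  rcases mem_homogeneousPart.mp hv i with ⟨h, h'⟩ | h
  · rw [if_pos h, homogeneousComponent_eq_self h']
  · simp [h]

theorem constantCoeff_eq_zero_of_mem_homogeneousPart {a : ι → ℕ} {n : ℕ}
    {v : ι → MvPolynomial σ R} (hv : v ∈ homogeneousPart σ R a n) {i : ι} (hi : a i ≠ n) :
    constantCoeff (v i) = 0 := by
  rcases mem_homogeneousPart.mp hv i with ⟨hle, hhom⟩ | h0
  · exact hhom.coeff_eq_zero (by simp only [map_zero]; omega)
  · rw [h0, map_zero]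

theorem sum_range_homogeneousComponent {p : MvPolynomial σ R} {N : ℕ} (hN : p.totalDegree < N) :
    ∑ n ∈ Finset.range N, homogeneousComponent n p = p := by
  conv_rhs => rw [← sum_homogeneousComponent p]
  refine (Finset.sum_subset (Finset.range_mono hN) fun n _ hn => ?_).symm
  exact homogeneousComponent_eq_zero _ _ (by simpa [Nat.lt_succ_iff] using hn)

theorem exists_sum_homogeneousProj_eq [Finite ι] (a : ι → ℕ) (v : ι → MvPolynomial σ R) :
    ∃ N, ∑ n ∈ Finset.range N, homogeneousProj σ R a n v = v := by
  cases nonempty_fintype ι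
  refine ⟨∑ i, (a i + ((v i).totalDegree + 1)), ?_⟩
  funext i
  have hle := Finset.single_le_sum (f := fun i => a i + ((v i).totalDegree + 1))
    (fun _ _ => Nat.zero_le _) (Finset.mem_univ i)
  obtain ⟨M, hM⟩ := Nat.exists_eq_add_of_le ((Nat.le_add_right _ _).trans hle)
  simp only [hM, Finset.sum_range_add, Finset.sum_apply, homogeneousProj_apply,
    Nat.le_add_right, if_true, Nat.add_sub_cancel_left]
  rw [Finset.sum_eq_zero fun n hn => if_neg (Finset.mem_range.mp hn).not_ge, zero_add]
  exact sum_range_homogeneousComponent (by omega)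

theorem map_apply_eq_sum [Fintype κ] [DecidableEq κ] {A : Type*} [CommSemiring A]
    (φ : (κ → A) →ₗ[A] (ι → A)) (w : κ → A) (i : ι) :
    φ w i = ∑ j, w j * φ (Pi.single j 1) i := by
  conv_lhs => rw [pi_eq_sum_univ' w]
  simp

theorem homogeneousProj_map [Finite κ] [DecidableEq κ] {b : κ → ℕ} {a : ι → ℕ}
    {φ : (κ → MvPolynomial σ R) →ₗ[MvPolynomial σ R] (ι → MvPolynomial σ R)}
    (hφ : ∀ j, φ (Pi.single j 1) ∈ homogeneousPart σ R a (b j)) (n : ℕ)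
    (v : κ → MvPolynomial σ R) :
    homogeneousProj σ R a n (φ v) = φ (homogeneousProj σ R b n v) := by
  cases nonempty_fintype κ
  funext i
  have hterm : ∀ j, (if a i ≤ n then homogeneousComponent (n - a i) (v j * φ (Pi.single j 1) i)
      else 0) = homogeneousProj σ R b n v j * φ (Pi.single j 1) i := fun j => by
    rw [homogeneousProj_apply]
    rcases mem_homogeneousPart.mp (hφ j) i with ⟨hle, hhom⟩ | h0
    · rw [homogeneousComponent_mul_of_isHomogeneous _ hhom, ite_mul, zero_mul, ← ite_and]
      refine if_ctx_congr (by omega) (fun hb => ?_) fun _ => rfl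
      rw [show n - a i - (b j - a i) = n - b j by omega]
    · simp [h0]
  rw [homogeneousProj_apply, map_apply_eq_sum φ v, map_apply_eq_sum φ (homogeneousProj σ R b n v),
    map_sum, ← Finset.sum_congr rfl fun j _ => hterm j]
  split_ifs <;> simp

end GradedFreeModules

section MinimalGenerators

variable {σ R ι κ : Type*} [CommRing R]

theorem constantCoeff_eq_zero_of_relation {K : Type*} [Field K] [Fintype κ] {b : κ → ℕ}
    {a : ι → ℕ} {g : κ → ι → MvPolynomial σ K}
    (hg : ∀ j, g j ∈ homogeneousPart σ K a (b j))
    (hmin : ∀ j, g j ∉ Submodule.span (MvPolynomial σ K) (g '' {j}ᶜ)) {u : κ → MvPolynomial σ K}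
    (hu : Fintype.linearCombination (MvPolynomial σ K) g u = 0) (j : κ) :
    constantCoeff (u j) = 0 := by
  classical
  by_contra hne
  set c := constantCoeff (u j)
  set w := homogeneousProj σ K b (b j) u
  have hw : Fintype.linearCombination (MvPolynomial σ K) g w = 0 := by
    rw [← homogeneousProj_map, hu, map_zero]
    simpa [Fintype.linearCombination_apply_single] using hg
  have hj : w j = C c := by simp [w, c, homogeneousProj_apply, constantCoeff_eq]
  rw [Fintype.linearCombination_apply, ← Finset.add_sum_erase _ _ (Finset.mem_univ j), hj] at hw
  have hmem : (C c : MvPolynomial σ K) • g j ∈ Submodule.span (MvPolynomial σ K) (g '' {j}ᶜ) := by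
    rw [eq_neg_of_add_eq_zero_left hw]
    refine neg_mem (Submodule.sum_mem _ fun l hl => Submodule.smul_mem _ _ ?_)
    exact Submodule.subset_span ⟨l, by simpa using hl, rfl⟩
  have hunit : IsUnit (C c : MvPolynomial σ K) := (isUnit_iff_ne_zero.mpr hne).map C
  exact hmin j ((Submodule.smul_mem_iff_of_isUnit _ hunit).mp hmem)

/-- `g j`, of degree `e j`, form a system of homogeneous generators of the submodule `N` of the
graded free module `⊕ᵢ P(-b i)` over `P = R[σ]`. -/
structure IsHomogeneousGenerators {n : ℕ} (b : κ → ℕ)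
    (N : Submodule (MvPolynomial σ R) (κ → MvPolynomial σ R))
    (e : Fin n → ℕ) (g : Fin n → κ → MvPolynomial σ R) : Prop where
  mem_homogeneousPart : ∀ j, g j ∈ homogeneousPart σ R b (e j)
  span_range_eq : Submodule.span (MvPolynomial σ R) (Set.range g) = N

theorem exists_isHomogeneousGenerators [Finite κ] {b : κ → ℕ}
    {N : Submodule (MvPolynomial σ R) (κ → MvPolynomial σ R)} (hfg : N.FG)
    (hN : ∀ n, ∀ v ∈ N, homogeneousProj σ R b n v ∈ N) :
    ∃ (n : ℕ) (e : Fin n → ℕ) (g : Fin n → κ → MvPolynomial σ R),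
      IsHomogeneousGenerators b N e g := by
  obtain ⟨k, v, hv⟩ := Submodule.fg_iff_exists_fin_generating_family.mp hfg
  choose M hM using fun i => exists_sum_homogeneousProj_eq b (v i)
  let E := (Fintype.equivFin (Σ i, Fin (M i))).symm
  refine ⟨_, fun j => (E j).2, fun j => homogeneousProj σ R b (E j).2 (v (E j).1),
    fun j => homogeneousProj_mem _ _ _, le_antisymm ?_ ?_⟩
  · rw [Submodule.span_le]
    rintro _ ⟨j, rfl⟩
    exact hN _ _ (hv ▸ Submodule.subset_span ⟨_, rfl⟩)
  · rw [← hv, Submodule.span_le]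
    rintro _ ⟨i, rfl⟩
    rw [SetLike.mem_coe, ← hM i]
    refine Submodule.sum_mem _ fun n hn => Submodule.subset_span ?_
    exact ⟨E.symm ⟨i, n, Finset.mem_range.mp hn⟩,
      congrArg (fun p => homogeneousProj σ R b p.2 (v p.1)) (E.apply_symm_apply _)⟩

theorem IsHomogeneousGenerators.comp_perm {n : ℕ} {b : κ → ℕ}
    {N : Submodule (MvPolynomial σ R) (κ → MvPolynomial σ R)} {e : Fin n → ℕ}
    {g : Fin n → κ → MvPolynomial σ R} (hg : IsHomogeneousGenerators b N e g)
    (s : Equiv.Perm (Fin n)) : IsHomogeneousGenerators b N (e ∘ s) (g ∘ s) :=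
  ⟨fun j => hg.1 (s j), by rw [s.surjective.range_comp, hg.2]⟩

theorem IsHomogeneousGenerators.comp_succAbove {n : ℕ} {b : κ → ℕ}
    {N : Submodule (MvPolynomial σ R) (κ → MvPolynomial σ R)} {e : Fin (n + 1) → ℕ}
    {g : Fin (n + 1) → κ → MvPolynomial σ R} (hg : IsHomogeneousGenerators b N e g)
    {j : Fin (n + 1)} (hj : g j ∈ Submodule.span (MvPolynomial σ R) (g '' {j}ᶜ)) :
    IsHomogeneousGenerators b N (e ∘ j.succAbove) (g ∘ j.succAbove) := by
  refine ⟨fun i => hg.1 _, ?_⟩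
  rw [Set.range_comp, Fin.range_succAbove, ← Submodule.span_insert_eq_span hj,
    ← Set.image_insert_eq, Set.insert_eq, Set.union_compl_self, Set.image_univ, hg.2]

theorem exists_monotone_minimal_isHomogeneousGenerators [Finite κ] {b : κ → ℕ}
    {N : Submodule (MvPolynomial σ R) (κ → MvPolynomial σ R)} (hfg : N.FG)
    (hN : ∀ n, ∀ v ∈ N, homogeneousProj σ R b n v ∈ N) :
    ∃ (n : ℕ) (e : Fin n → ℕ) (g : Fin n → κ → MvPolynomial σ R), Monotone e ∧
      IsHomogeneousGenerators b N e g ∧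
        ∀ j, g j ∉ Submodule.span (MvPolynomial σ R) (g '' {j}ᶜ) := by
  classical
  have hex := exists_isHomogeneousGenerators hfg hN
  obtain ⟨e, g, hg⟩ := Nat.find_spec hex
  have hmin := fun l (hl : l < Nat.find hex) => Nat.find_min hex hl
  generalize Nat.find hex = n at *
  refine ⟨n, _, _, Tuple.monotone_sort e, hg.comp_perm _, fun j hj => ?_⟩
  obtain _ | n := n
  · exact j.elim0
  · exact hmin n n.lt_succ_self ⟨_, _, (hg.comp_perm _).comp_succAbove hj⟩

end MinimalGenerators

section RegularSequences

variable {R : Type*} [CommRing R] {M M' : Type*} [AddCommGroup M] [Module R M]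
  [AddCommGroup M'] [Module R M']

theorem isWeaklyRegular_pi {rs : List R} (h : IsWeaklyRegular R rs) (ι : Type*) [Finite ι] :
    IsWeaklyRegular (ι → R) rs :=
  ((TensorProduct.rid R (ι → R)).isWeaklyRegular_congr rs).mp h.isWeaklyRegular_lTensor

theorem injective_map_quotSMulTop {M'' : Type*} [AddCommGroup M''] [Module R M'']
    {i : M →ₗ[R] M'} {p : M' →ₗ[R] M''} (hi : Function.Injective i) (hip : Function.Exact i p)
    {r : R} (hr : IsSMulRegular M'' r) : Function.Injective (QuotSMulTop.map r i) := by
  rw [← LinearMap.exact_zero_iff_injective (QuotSMulTop r M)]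
  simpa using QuotSMulTop.map_first_exact_on_four_term_exact_of_isSMulRegular_last
        ((LinearMap.exact_zero_iff_injective M i).mpr hi) hip hr

-- The depth lemma: along a short exact sequence `depth M ≥ min (depth M') (depth M'' + 1)`.
theorem isWeaklyRegular_of_exact {M'' : Type*} [AddCommGroup M''] [Module R M''] {rs : List R}
    {r : R} {i : M →ₗ[R] M'} {p : M' →ₗ[R] M''} (hi : Function.Injective i)
    (hip : Function.Exact i p) (hp : Function.Surjective p) (h'' : IsWeaklyRegular M'' rs)
    (h' : IsWeaklyRegular M' (rs ++ [r])) : IsWeaklyRegular M (rs ++ [r]) := by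
  induction h'' generalizing M M' with
  | nil M'' =>
    simp only [List.nil_append, isWeaklyRegular_singleton_iff] at h' ⊢
    exact h'.of_injective i hi
  | @cons M'' _ _ s rs hs _ ih =>
    simp only [List.cons_append, isWeaklyRegular_cons_iff] at h' ⊢
    exact ⟨h'.1.of_injective i hi, ih (injective_map_quotSMulTop hi hip hs)
      (QuotSMulTop.map_exact s hip hp) (QuotSMulTop.map_surjective s hp) h'.2⟩

theorem isWeaklyRegular_ker {rs : List R} {r : R} {f : M →ₗ[R] M'}
    (hM : IsWeaklyRegular M (rs ++ [r])) (hf : IsWeaklyRegular (LinearMap.range f) rs) :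
    IsWeaklyRegular (LinearMap.ker f) (rs ++ [r]) :=
  isWeaklyRegular_of_exact f.ker.injective_subtype
    (LinearMap.exact_iff.mpr (by rw [LinearMap.ker_rangeRestrict, Submodule.range_subtype]))
    f.surjective_rangeRestrict hf hM

theorem mem_smul_top_of_coe_mem_smul_top {rs : List R} {f : M →ₗ[R] M'}
    (hf : IsWeaklyRegular (LinearMap.range f) rs) {v : LinearMap.ker f}
    (hv : (v : M) ∈ (Ideal.ofList rs • ⊤ : Submodule R M)) :
    v ∈ (Ideal.ofList rs • ⊤ : Submodule R (LinearMap.ker f)) := by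
  have hexact := map_first_exact_on_four_term_right_exact_of_isSMulRegular_last
    ((LinearMap.exact_zero_iff_injective PUnit _).mpr f.ker.injective_subtype)
    (LinearMap.exact_iff.mpr (by rw [LinearMap.ker_rangeRestrict, Submodule.range_subtype]))
    f.surjective_rangeRestrict hf
  rw [Submodule.mapQ_zero, LinearMap.exact_zero_iff_injective] at hexact
  rw [← Submodule.Quotient.mk_eq_zero] at hv ⊢
  exact hexact (by simpa using hv)

theorem mem_smul_top_of_forall_mem {ι R : Type*} [Finite ι] [CommSemiring R] {I : Ideal R}
    {v : ι → R} (hv : ∀ i, v i ∈ I) : v ∈ (I • ⊤ : Submodule R (ι → R)) := by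
  classical
  cases nonempty_fintype ι
  rw [pi_eq_sum_univ' v]
  exact Submodule.sum_mem _ fun i _ => Submodule.smul_mem_smul (hv i) trivial

theorem injective_of_exact {ι κ τ : Type*} [Finite ι] [Finite κ] [Finite τ] [IsDomain R]
    [IsNoetherianRing R] {x y z : R} (hreg : IsWeaklyRegular R [x, y, z])
    (hne : Ideal.ofList [x, y, z] ≠ ⊤)
    {ψ : (ι → R) →ₗ[R] R} {φ : (κ → R) →ₗ[R] (ι → R)}
    {χ : (τ → R) →ₗ[R] (κ → R)} (h₁ : Function.Exact φ ψ) (h₂ : Function.Exact χ φ)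
    (hmin : ∀ u, χ u = 0 → ∀ i, u i ∈ Ideal.ofList [x, y, z]) : Function.Injective χ := by
  have hreg₂ := ((isWeaklyRegular_append_iff R [x, y] [z]).mp hreg).1
  have hψ : IsWeaklyRegular (LinearMap.range ψ) [x] := by
    rw [isWeaklyRegular_singleton_iff]
    rw [isWeaklyRegular_cons_iff] at hreg
    exact hreg.1.submodule _ _
  have hφ : IsWeaklyRegular (LinearMap.range φ) [x, y] := by
    rw [← h₁.linearMap_ker_eq]
    exact isWeaklyRegular_ker (rs := [x]) (isWeaklyRegular_pi hreg₂ ι) hψ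
  have hχ : IsWeaklyRegular (LinearMap.range χ) [x, y, z] := by
    rw [← h₂.linearMap_ker_eq]
    exact isWeaklyRegular_ker (rs := [x, y]) (isWeaklyRegular_pi hreg κ) hφ
  have hle : (⊤ : Submodule R (LinearMap.ker χ)) ≤ Ideal.ofList [x, y, z] • ⊤ := fun u _ =>
    mem_smul_top_of_coe_mem_smul_top hχ (mem_smul_top_of_forall_mem (hmin u u.2))
  obtain ⟨r, hr, hru⟩ := Submodule.exists_sub_one_mem_and_smul_eq_zero_of_fg_of_le_smul _ ⊤
    (IsNoetherian.noetherian _) hle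
  have hr0 : r ≠ 0 := by
    rintro rfl
    exact (Ideal.ne_top_iff_one _).mp hne (by simpa using hr)
  rw [injective_iff_map_eq_zero]
  intro u hu
  exact (smul_eq_zero.mp (congrArg Subtype.val (hru ⟨u, hu⟩ trivial))).resolve_left hr0

theorem mem_span_X_image_of_X_mul_mem {σ R : Type*} [CommSemiring R] {s : Set σ} {i : σ}
    (hi : i ∉ s) {p : MvPolynomial σ R}
    (hp : X i * p ∈ Ideal.span (X '' s : Set (MvPolynomial σ R))) :
    p ∈ Ideal.span (X '' s : Set (MvPolynomial σ R)) := by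
  rw [mem_ideal_span_X_image] at hp ⊢
  intro m hm
  obtain ⟨j, hj, hne⟩ := hp (Finsupp.single i 1 + m) (by simpa [coeff_X_mul] using hm)
  have hji : i ≠ j := by rintro rfl; exact hi hj
  exact ⟨j, hj, by simpa [Finsupp.single_eq_of_ne' hji] using hne⟩

theorem ofList_map_X {σ R : Type*} [CommSemiring R] (l : List σ) :
    Ideal.ofList (l.map (X : σ → MvPolynomial σ R)) = Ideal.span (X '' {i | i ∈ l}) := by
  simp only [Ideal.ofList, List.mem_map, Set.image, Set.mem_ofPred_eq]

theorem isWeaklyRegular_map_X {σ R : Type*} [CommRing R] {l : List σ} (hl : l.Nodup) :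
    IsWeaklyRegular (MvPolynomial σ R) (l.map (X : σ → MvPolynomial σ R)) := by
  refine ⟨fun i hi => (isSMulRegular_quotient_iff_mem_of_smul_mem _ _).mpr fun p hp => ?_⟩
  rw [← List.map_take, smul_eq_mul, Ideal.mul_top, ofList_map_X] at hp ⊢
  rw [List.getElem_map, smul_eq_mul] at hp
  refine mem_span_X_image_of_X_mul_mem (fun hmem => ?_) hp
  obtain ⟨j, hj, hji⟩ := List.mem_take_iff_getElem.mp hmem
  have := hl.getElem_inj_iff.mp hji
  omega

theorem idealOfVars_eq_ker_constantCoeff (σ R : Type*) [CommRing R] :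
    idealOfVars σ R = RingHom.ker constantCoeff := by
  ext p
  rw [← pow_one (idealOfVars σ R), mem_pow_idealOfVars_iff', RingHom.mem_ker, constantCoeff_eq]
  simp [Finsupp.degree_eq_zero_iff]

theorem ofList_X_eq_ker_constantCoeff (R : Type*) [CommRing R] :
    Ideal.ofList [X 0, X 1, X 2] =
      RingHom.ker (constantCoeff : MvPolynomial (Fin 3) R →+* R) := by
  have huniv : {i : Fin 3 | i ∈ [0, 1, 2]} = Set.univ := by ext i; fin_cases i <;> simp
  rw [← idealOfVars_eq_ker_constantCoeff, idealOfVars, ← Set.image_univ, ← huniv, ← ofList_map_X]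
  rfl

theorem injective_of_exact_of_constantCoeff_eq_zero [IsDomain R] [IsNoetherianRing R]
    {ι κ τ : Type*} [Finite ι] [Finite κ] [Finite τ]
    {ψ : (ι → MvPolynomial (Fin 3) R) →ₗ[MvPolynomial (Fin 3) R] MvPolynomial (Fin 3) R}
    {φ : (κ → MvPolynomial (Fin 3) R) →ₗ[MvPolynomial (Fin 3) R] (ι → MvPolynomial (Fin 3) R)}
    {χ : (τ → MvPolynomial (Fin 3) R) →ₗ[MvPolynomial (Fin 3) R] (κ → MvPolynomial (Fin 3) R)}
    (h₁ : Function.Exact φ ψ) (h₂ : Function.Exact χ φ)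
    (hmin : ∀ u, χ u = 0 → ∀ i, constantCoeff (u i) = 0) : Function.Injective χ := by
  refine injective_of_exact (isWeaklyRegular_map_X (l := [0, 1, 2]) (by decide)) ?_ h₁ h₂ ?_
  · exact (ofList_X_eq_ker_constantCoeff R).trans_ne (RingHom.ker_ne_top _)
  · intro u hu i
    exact (ofList_X_eq_ker_constantCoeff R).ge (hmin u hu i)

end RegularSequences

section Uniqueness

variable {A k M ι κ : Type*} [CommRing A] [CommRing k] [AddCommGroup M] [Module A M]
  {g : ι → M} {h : κ → M}

theorem exists_linearCombination_eq_of_span_eq [Fintype ι]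
    (hspan : Submodule.span A (Set.range g) = Submodule.span A (Set.range h)) :
    ∃ C : κ → ι → A, ∀ j, Fintype.linearCombination A g (C j) = h j := by
  have hmem : ∀ j, h j ∈ LinearMap.range (Fintype.linearCombination A g) := fun j => by
    rw [Fintype.range_linearCombination, hspan]
    exact Submodule.subset_span ⟨j, rfl⟩
  choose C hC using hmem
  exact ⟨C, hC⟩

theorem of_map_mul_of_map_eq_one_of_relation [Fintype ι] [Fintype κ] [DecidableEq ι] (π : A →+* k)
    (hrel : ∀ u, Fintype.linearCombination A g u = 0 → ∀ i, π (u i) = 0)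
    {B : ι → κ → A} {C : κ → ι → A} (hB : ∀ i, Fintype.linearCombination A h (B i) = g i)
    (hC : ∀ j, Fintype.linearCombination A g (C j) = h j) :
    (Matrix.of B).map π * (Matrix.of C).map π = 1 := by
  ext i i'
  have hu : Fintype.linearCombination A g (∑ j, B i j • C j - Pi.single i 1) = 0 := by
    rw [map_sub, map_sum, Fintype.linearCombination_apply_single, one_smul, sub_eq_zero, ← hB i,
      Fintype.linearCombination_apply]
    exact Finset.sum_congr rfl fun j _ => by rw [map_smul, hC]
  have hπ := hrel _ hu i'
  rw [Pi.sub_apply, map_sub, sub_eq_zero] at hπ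
  simpa [Matrix.mul_apply, Matrix.one_apply, Pi.single_apply, apply_ite π, eq_comm] using hπ

theorem card_eq_of_span_eq_of_relation [Fintype ι] [Fintype κ] [Nontrivial k] (π : A →+* k)
    (hspan : Submodule.span A (Set.range g) = Submodule.span A (Set.range h))
    (hg : ∀ u, Fintype.linearCombination A g u = 0 → ∀ i, π (u i) = 0)
    (hh : ∀ u, Fintype.linearCombination A h u = 0 → ∀ j, π (u j) = 0) :
    Fintype.card ι = Fintype.card κ := by
  classical
  obtain ⟨C, hC⟩ := exists_linearCombination_eq_of_span_eq hspan
  obtain ⟨B, hB⟩ := exists_linearCombination_eq_of_span_eq hspan.symm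
  exact Matrix.square_of_invertible _ _ (of_map_mul_of_map_eq_one_of_relation π hg hB hC)
    (of_map_mul_of_map_eq_one_of_relation π hh hC hB)

theorem exists_degree_eq_of_span_eq_of_relation [Finite ι] [Fintype κ] {σ R τ : Type*}
    [CommRing R] [Nontrivial R]
    {a : τ → ℕ} {b : ι → ℕ} {c : κ → ℕ} {g : ι → τ → MvPolynomial σ R}
    {h : κ → τ → MvPolynomial σ R}
    (hspan : Submodule.span (MvPolynomial σ R) (Set.range g) =
      Submodule.span (MvPolynomial σ R) (Set.range h))
    (hg : ∀ i, g i ∈ homogeneousPart σ R a (b i)) (hh : ∀ j, h j ∈ homogeneousPart σ R a (c j))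
    (hrel : ∀ u, Fintype.linearCombination (MvPolynomial σ R) h u = 0 →
      ∀ j, constantCoeff (u j) = 0) (j : κ) : ∃ i, b i = c j := by
  classical
  cases nonempty_fintype ι
  by_contra! hne
  obtain ⟨B, hB⟩ := exists_linearCombination_eq_of_span_eq hspan.symm
  obtain ⟨C, hC⟩ := exists_linearCombination_eq_of_span_eq hspan
  let C' : κ → ι → MvPolynomial σ R := fun j => homogeneousProj σ R b (c j) (C j)
  have hC' : ∀ j, Fintype.linearCombination (MvPolynomial σ R) g (C' j) = h j := fun j => by
    rw [← homogeneousProj_map (by simpa [Fintype.linearCombination_apply_single] using hg), hC,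
      homogeneousProj_of_mem (hh j)]
  have hCj : ∀ i, constantCoeff (C' j i) = 0 := fun i =>
    constantCoeff_eq_zero_of_mem_homogeneousPart (homogeneousProj_mem b (c j) (C j)) (hne i)
  have hjj := congrFun₂ (of_map_mul_of_map_eq_one_of_relation constantCoeff hrel hC' hB) j j
  simp [Matrix.mul_apply, hCj] at hjj

end Uniqueness

section Resolutions

theorem exists_injective_exact_of_exact {K ι κ : Type*} [Field K] [Finite ι] [Finite κ]
    [DecidableEq κ] {a : ι → ℕ} {b : κ → ℕ}
    {ψ : (ι → MvPolynomial (Fin 3) K) →ₗ[MvPolynomial (Fin 3) K] MvPolynomial (Fin 3) K}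
    {φ : (κ → MvPolynomial (Fin 3) K) →ₗ[MvPolynomial (Fin 3) K] (ι → MvPolynomial (Fin 3) K)}
    (hφ : ∀ j, φ (Pi.single j 1) ∈ homogeneousPart (Fin 3) K a (b j))
    (hex : Function.Exact φ ψ) :
    ∃ (n : ℕ) (e : Fin n → ℕ) (g : Fin n → κ → MvPolynomial (Fin 3) K), Monotone e ∧
      (∀ j, g j ∈ homogeneousPart (Fin 3) K b (e j)) ∧
        Function.Exact (Fintype.linearCombination (MvPolynomial (Fin 3) K) g) φ ∧
          Function.Injective (Fintype.linearCombination (MvPolynomial (Fin 3) K) g) := by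
  obtain ⟨n, e, g, hmono, ⟨hg, hspan⟩, hmin⟩ :=
    exists_monotone_minimal_isHomogeneousGenerators (b := b) (N := LinearMap.ker φ)
      (IsNoetherian.noetherian _) fun n v hv => by
        rw [LinearMap.mem_ker, ← homogeneousProj_map hφ, LinearMap.mem_ker.mp hv, map_zero]
  have hexact : Function.Exact (Fintype.linearCombination (MvPolynomial (Fin 3) K) g) φ := by
    rw [LinearMap.exact_iff, Fintype.range_linearCombination, hspan]
  exact ⟨n, e, g, hmono, hg, hexact, injective_of_exact_of_constantCoeff_eq_zero hex hexact
    fun u hu => constantCoeff_eq_zero_of_relation hg hmin hu⟩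

theorem finrank_range_add_finrank_ker_of_isDomain {R M N : Type*} [CommRing R] [IsDomain R]
    [AddCommGroup M] [Module R M] [Module.Finite R M] [AddCommGroup N] [Module R N]
    (φ : M →ₗ[R] N) :
    Module.finrank R (LinearMap.range φ) + Module.finrank R (LinearMap.ker φ) =
      Module.finrank R M := by
  rw [← φ.quotKerEquivRange.finrank_eq, Submodule.finrank_quotient_add_finrank]

theorem finrank_ker_add_one_of_ne_zero {R M : Type*} [CommRing R] [IsDomain R]
    [AddCommGroup M] [Module R M] [Module.Finite R M] {φ : M →ₗ[R] R} (hφ : φ ≠ 0) :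
    Module.finrank R (LinearMap.ker φ) + 1 = Module.finrank R M := by
  rw [← finrank_range_add_finrank_ker_of_isDomain φ, add_comm, add_left_inj, eq_comm]
  refine le_antisymm ?_ ?_
  · simpa using Submodule.finrank_le (LinearMap.range φ)
  · rw [Nat.one_le_iff_ne_zero, ← Nat.pos_iff_ne_zero, Module.finrank_pos_iff,
      Submodule.nontrivial_iff_ne_bot]
    rwa [Ne, LinearMap.range_eq_bot]

theorem exists_pderiv_ne_zero {σ R : Type*} [Finite σ] [CommRing R] [IsDomain R] [CharZero R]
    {f : MvPolynomial σ R} {d : ℕ} (hd : d ≠ 0) (hf : f.IsHomogeneous d) (h0 : f ≠ 0) :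
    ∃ i, pderiv i f ≠ 0 := by
  cases nonempty_fintype σ
  by_contra! h
  have heuler := hf.sum_X_mul_pderiv
  simp only [h, mul_zero, Finset.sum_const_zero] at heuler
  exact smul_ne_zero hd h0 heuler.symm

variable {f : S} {d r m : ℕ} {ρ : Fin m → Fin 3 → S}

theorem gradientMap_ne_zero (hd : d ≠ 0) (hf : f.IsHomogeneous d) (h0 : f ≠ 0) :
    gradientMap f ≠ 0 := by
  obtain ⟨i, hi⟩ := exists_pderiv_ne_zero hd hf h0
  intro hzero
  have hsingle := LinearMap.congr_fun hzero (Pi.single i 1)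
  rw [gradientMap, Fintype.linearCombination_apply_single, one_smul] at hsingle
  exact hi hsingle

theorem finrank_jacobianSyzygies (hd : d ≠ 0) (hf : f.IsHomogeneous d) (h0 : f ≠ 0) :
    Module.finrank S (jacobianSyzygies f) = 2 := by
  have hrank := finrank_ker_add_one_of_ne_zero (gradientMap_ne_zero hd hf h0)
  rw [Module.finrank_fin_fun] at hrank
  exact Nat.succ_injective hrank

theorem IsMinimalGenerators.mem_homogeneousPart {deg : Fin m → ℕ}
    (hρ : IsMinimalGenerators f deg ρ) (c : ℕ) (j : Fin m) :
    ρ j ∈ homogeneousPart (Fin 3) ℂ (fun _ => c) (c + deg j) :=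
  PlaneCurve.mem_homogeneousPart.mpr fun i =>
    Or.inl ⟨Nat.le_add_right _ _, by simpa using hρ.homogeneous j i⟩

theorem IsMinimalGenerators.exact {deg : Fin m → ℕ} (hρ : IsMinimalGenerators f deg ρ) :
    Function.Exact (Fintype.linearCombination S ρ) (gradientMap f) := by
  rw [LinearMap.exact_iff, Fintype.range_linearCombination, hρ.span_eq]
  rfl

theorem isGradedMap_iff {ι κ : Type} [DecidableEq κ] {b : κ → ℕ} {a : ι → ℕ}
    {φ : (κ → S) →ₗ[S] (ι → S)} :
    IsGradedMap b a φ ↔ ∀ j, φ (Pi.single j 1) ∈ homogeneousPart (Fin 3) ℂ a (b j) :=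
  forall_congr' fun _ => mem_homogeneousPart.symm

theorem isGradedMap_linearCombination {ι κ : Type} [Fintype κ] [DecidableEq κ] {b : κ → ℕ}
    {a : ι → ℕ} {g : κ → ι → S} (hg : ∀ j, g j ∈ homogeneousPart (Fin 3) ℂ a (b j)) :
    IsGradedMap b a (Fintype.linearCombination S g) :=
  isGradedMap_iff.mpr fun j => by
    rw [Fintype.linearCombination_apply_single, one_smul]
    exact hg j

theorem isMinimalMap_linearCombination {ι κ : Type} [Fintype κ] [DecidableEq κ]
    {g : κ → ι → S} (hg : ∀ j i, constantCoeff (g j i) = 0) :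
    IsMinimalMap (Fintype.linearCombination S g) := fun j i => by
  rw [Fintype.linearCombination_apply_single, one_smul]
  exact hg j i

theorem nonempty_minimalResolution (hd : 2 ≤ d) (hf : f.IsHomogeneous d) (h0 : f ≠ 0)
    (hr : r ≠ 0) (hρ : IsMinimalGenerators f (fun _ => r) ρ) :
    Nonempty (MinimalResolution f d) := by
  have hρhom := hρ.mem_homogeneousPart (d - 1)
  have hgr := isGradedMap_linearCombination hρhom
  obtain ⟨n, e, g, hmono, hg, hexact, hinj⟩ :=
    exists_injective_exact_of_exact (isGradedMap_iff.mp hgr) hρ.exact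
  have hn : m = n + 2 := by
    have hrank := finrank_range_add_finrank_ker_of_isDomain (Fintype.linearCombination S ρ)
    rw [hρ.exact.linearMap_ker_eq.symm, hexact.linearMap_ker_eq,
      LinearMap.finrank_range_of_inj hinj, Module.finrank_fin_fun,
      Module.finrank_fin_fun] at hrank
    have hsyz : Module.finrank S (LinearMap.ker (gradientMap f)) = 2 :=
      finrank_jacobianSyzygies (by omega) hf h0
    omega
  subst hn
  exact ⟨{
    k := n
    deg := fun _ => r
    e := e
    deg_mono := monotone_const
    e_mono := hmono
    φ₂ := Fintype.linearCombination S ρ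
    φ₃ := Fintype.linearCombination S g
    graded₂ := hgr
    graded₃ := isGradedMap_linearCombination hg
    exact₁ := hρ.exact
    exact₂ := hexact
    injective₃ := hinj
    minimal₁ := fun i => hf.pderiv.coeff_eq_zero (by simp only [map_zero]; omega)
    minimal₂ := isMinimalMap_linearCombination fun j i =>
      constantCoeff_eq_zero_of_mem_homogeneousPart (hρhom j) (by omega)
    minimal₃ := isMinimalMap_linearCombination fun j =>
      constantCoeff_eq_zero_of_relation hρhom hρ.minimal <| by
        have := hexact.apply_apply_eq_zero (Pi.single j 1)
        rwa [Fintype.linearCombination_apply_single, one_smul] at this }⟩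

theorem linearCombination_apply_single_one {A M ι : Type*} [CommSemiring A] [AddCommMonoid M]
    [Module A M] [Fintype ι] [DecidableEq ι] (φ : (ι → A) →ₗ[A] M) :
    Fintype.linearCombination A (fun j => φ (Pi.single j 1)) = φ := by
  refine LinearMap.pi_ext' fun j => LinearMap.ext_ring ?_
  simp

namespace MinimalResolution

variable (R : MinimalResolution f d)

theorem constantCoeff_eq_zero_of_relation {u : Fin (R.k + 2) → S} (hu : R.φ₂ u = 0)
    (j : Fin (R.k + 2)) : constantCoeff (u j) = 0 := by
  obtain ⟨w, rfl⟩ := (R.exact₂ u).mp hu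
  rw [map_apply_eq_sum, map_sum]
  exact Finset.sum_eq_zero fun i _ => by rw [map_mul, R.minimal₃, mul_zero]

theorem span_range_φ₂ :
    Submodule.span S (Set.range fun j => R.φ₂ (Pi.single j 1)) = jacobianSyzygies f := by
  rw [← Fintype.range_linearCombination, linearCombination_apply_single_one]
  exact R.exact₁.linearMap_ker_eq.symm

theorem k_add_two_eq {deg : Fin m → ℕ} (hρ : IsMinimalGenerators f deg ρ) : R.k + 2 = m := by
  have hcard := card_eq_of_span_eq_of_relation constantCoeff
    (R.span_range_φ₂.trans hρ.span_eq.symm)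
    (fun u hu => R.constantCoeff_eq_zero_of_relation
      (by rwa [linearCombination_apply_single_one] at hu))
    (fun u hu => PlaneCurve.constantCoeff_eq_zero_of_relation (hρ.mem_homogeneousPart 0)
      hρ.minimal hu)
  simpa using hcard

theorem exists_deg_eq {deg : Fin m → ℕ} (hρ : IsMinimalGenerators f deg ρ)
    (j : Fin (R.k + 2)) : ∃ i, deg i = R.deg j := by
  obtain ⟨i, hi⟩ := exists_degree_eq_of_span_eq_of_relation
    (hρ.span_eq.trans R.span_range_φ₂.symm) (hρ.mem_homogeneousPart (d - 1))
    (isGradedMap_iff.mp R.graded₂)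
    (fun u hu => R.constantCoeff_eq_zero_of_relation
      (by rwa [linearCombination_apply_single_one] at hu)) j
  exact ⟨i, Nat.add_left_cancel hi⟩

end MinimalResolution

end Resolutions

section HilbertFunctions

section Projections

variable {K V W X : Type*} [Field K] [AddCommGroup V] [Module K V] [AddCommGroup W] [Module K W]
  [AddCommGroup X] [Module K X]

theorem map_eq_inf_range_of_isProj {P : Submodule K V} {Q : Submodule K W} {p : V →ₗ[K] V}
    {q : W →ₗ[K] W} {T : V →ₗ[K] W} (hp : LinearMap.IsProj P p) (hq : LinearMap.IsProj Q q)
    (hT : ∀ v, q (T v) = T (p v)) : P.map T = Q ⊓ LinearMap.range T := by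
  ext w
  constructor
  · rintro ⟨v, hv, rfl⟩
    rw [← hp.map_id v hv, ← hT]
    exact ⟨hq.map_mem _, v, by rw [hT, hp.map_id v hv]⟩
  · rintro ⟨hw, v, rfl⟩
    exact ⟨p v, hp.map_mem v, by rw [← hT, hq.map_id _ hw]⟩

theorem finrank_map_add_finrank_inf_ker (Q : Submodule K W) [Module.Finite K Q] (L : W →ₗ[K] X) :
    Module.finrank K (Q.map L) + Module.finrank K ↥(Q ⊓ LinearMap.ker L) = Module.finrank K Q := by
  rw [← LinearMap.finrank_range_add_finrank_ker (L.domRestrict Q), LinearMap.range_domRestrict,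
    LinearMap.ker_domRestrict, ← Submodule.map_comap_subtype]
  congr 1
  exact (Submodule.equivMapOfInjective Q.subtype Q.injective_subtype _).symm.finrank_eq

end Projections

section FiniteDimensional

variable {R : Type*} [CommRing R]

/-- A product of submodules, as a submodule of the product of the ambient modules, is the product
of the underlying modules. -/
def submodulePiEquiv {ι : Type*} {V : ι → Type*} [∀ i, AddCommGroup (V i)] [∀ i, Module R (V i)]
    (p : ∀ i, Submodule R (V i)) : Submodule.pi Set.univ p ≃ₗ[R] ∀ i, p i where
  toFun v i := ⟨v.1 i, v.2 i trivial⟩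
  map_add' _ _ := rfl
  map_smul' _ _ := rfl
  invFun w := ⟨fun i => w i, fun i _ => (w i).2⟩
  left_inv _ := rfl
  right_inv _ := rfl

theorem finrank_homogeneousSubmodule {σ : Type*} [Fintype σ] [Nontrivial R] (n : ℕ) :
    Module.finrank R (homogeneousSubmodule σ R n) = (Fintype.card σ + n - 1).choose n := by
  classical
  have hset : {d : σ →₀ ℕ | d.degree = n} =
      ((Finset.univ.finsuppAntidiag n : Finset (σ →₀ ℕ)) : Set (σ →₀ ℕ)) := by
    ext d
    simp [Finsupp.degree_eq_sum]
  rw [homogeneousSubmodule_eq_finsupp_supported, hset,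
    (AddMonoidAlgebra.supportedEquivFinsupp _).finrank_eq, Module.finrank_finsupp_self]
  simp only [Finset.coe_sort_coe, Fintype.card_coe,
    Finset.card_finsuppAntidiag_nat_eq_choose, Finset.card_univ]

theorem finite_homogeneousPart {K σ ι : Type*} [Field K] [Finite σ] [Finite ι] (a : ι → ℕ)
    (n : ℕ) : Module.Finite K (homogeneousPart σ K a n) := by
  have hfin : ∀ i, Module.Finite K
      ↥(if a i ≤ n then homogeneousSubmodule σ K (n - a i) else ⊥) := fun i => by
    rw [Module.Finite.iff_fg]
    split_ifs
    exacts [homogeneousSubmodule_fg σ K _, Submodule.fg_bot]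
  exact Module.Finite.equiv (submodulePiEquiv _).symm

theorem finrank_homogeneousSubmodule_fin_three [Nontrivial R] (n : ℕ) :
    (Module.finrank R (homogeneousSubmodule (Fin 3) R n) : ℚ) = ((n : ℚ) + 1) * (n + 2) / 2 := by
  rw [finrank_homogeneousSubmodule, Fintype.card_fin, show 3 + n - 1 = n + 2 by omega,
    Nat.choose_symm_add, Nat.cast_choose_two]
  push_cast
  ring

theorem finrank_homogeneousPart {K ι : Type*} [Field K] [Fintype ι] {a : ι → ℕ} {n : ℕ}
    (hn : ∀ i, a i ≤ n) :
    (Module.finrank K (homogeneousPart (Fin 3) K a n) : ℚ) =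
      ∑ i, ((n : ℚ) - a i + 1) * (n - a i + 2) / 2 := by
  have hfin : ∀ m, Module.Finite K (homogeneousSubmodule (Fin 3) K m) := fun m =>
    Module.Finite.iff_fg.mpr (homogeneousSubmodule_fg _ K m)
  rw [homogeneousPart, funext fun i => if_pos (hn i), (submodulePiEquiv _).finrank_eq,
    Module.finrank_pi_fintype, Nat.cast_sum]
  refine Finset.sum_congr rfl fun i _ => ?_
  rw [finrank_homogeneousSubmodule_fin_three, Nat.cast_sub (hn i)]

end FiniteDimensional

variable {σ K ι κ : Type*} [Field K]

theorem isProj_homogeneousProj (a : ι → ℕ) (n : ℕ) :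
    LinearMap.IsProj (homogeneousPart σ K a n) (homogeneousProj σ K a n) :=
  ⟨homogeneousProj_mem a n, fun _ => homogeneousProj_of_mem⟩

theorem isProj_homogeneousComponent (n : ℕ) :
    LinearMap.IsProj (homogeneousSubmodule σ K n) (homogeneousComponent n) :=
  ⟨homogeneousComponent_isHomogeneous n, fun _ => homogeneousComponent_eq_self⟩

theorem finrank_homogeneousPart_eq_of_exact [Finite σ] [Finite ι] [Finite κ] [DecidableEq κ]
    {a : ι → ℕ} {b : κ → ℕ} {M : Type*} [AddCommGroup M] [Module (MvPolynomial σ K) M]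
    [Module K M] [IsScalarTower K (MvPolynomial σ K) M]
    {φ : (κ → MvPolynomial σ K) →ₗ[MvPolynomial σ K] (ι → MvPolynomial σ K)}
    {ψ : (ι → MvPolynomial σ K) →ₗ[MvPolynomial σ K] M}
    (hφ : ∀ j, φ (Pi.single j 1) ∈ homogeneousPart σ K a (b j)) (hex : Function.Exact φ ψ)
    (n : ℕ) :
    Module.finrank K (homogeneousPart σ K a n) =
      Module.finrank K ((homogeneousPart σ K a n).map (ψ.restrictScalars K)) +
        Module.finrank K ((homogeneousPart σ K b n).map (φ.restrictScalars K)) := by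
  have := finite_homogeneousPart (K := K) (σ := σ) a n
  have hex' : Function.Exact (φ.restrictScalars K) (ψ.restrictScalars K) := hex
  rw [map_eq_inf_range_of_isProj (isProj_homogeneousProj b n) (isProj_homogeneousProj a n)
    (homogeneousProj_map hφ n), ← hex'.linearMap_ker_eq, finrank_map_add_finrank_inf_ker]

theorem finrank_map_of_injective {M N : Type*} [AddCommGroup M] [Module K M] [AddCommGroup N]
    [Module K N] {φ : M →ₗ[K] N} (hφ : Function.Injective φ) (P : Submodule K M) :
    Module.finrank K (P.map φ) = Module.finrank K P :=
  (Submodule.equivMapOfInjective φ hφ P).symm.finrank_eq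

/-- The component of degree `n` of the graded algebra `P / I`, where `P = K[σ]`: the classes of the
forms of degree `n`. For the Jacobian ideal it is `milnorComponent`. -/
noncomputable def quotientComponent (I : Ideal (MvPolynomial σ K)) (n : ℕ) :
    Submodule K (MvPolynomial σ K ⧸ I) :=
  (homogeneousSubmodule σ K n).map (Ideal.Quotient.mkₐ K I).toLinearMap

theorem finrank_quotientComponent_add [Finite σ] (I : Ideal (MvPolynomial σ K)) (n : ℕ) :
    Module.finrank K (quotientComponent I n) +
        Module.finrank K ↥(homogeneousSubmodule σ K n ⊓ I.restrictScalars K) =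
      Module.finrank K (homogeneousSubmodule σ K n) := by
  have : Module.Finite K (homogeneousSubmodule σ K n) :=
    Module.Finite.iff_fg.mpr (homogeneousSubmodule_fg σ K n)
  have hker : LinearMap.ker (Ideal.Quotient.mkₐ K I).toLinearMap = I.restrictScalars K := by
    ext p
    exact Ideal.Quotient.eq_zero_iff_mem
  rw [quotientComponent, ← hker, finrank_map_add_finrank_inf_ker]

theorem finrank_quotientComponent_anti [Finite σ] {I J : Ideal (MvPolynomial σ K)} (hIJ : I ≤ J)
    (n : ℕ) :
    Module.finrank K (quotientComponent J n) ≤ Module.finrank K (quotientComponent I n) := by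
  have : Module.Finite K (homogeneousSubmodule σ K n) :=
    Module.Finite.iff_fg.mpr (homogeneousSubmodule_fg σ K n)
  have hfin : Module.Finite K ↥(homogeneousSubmodule σ K n ⊓ J.restrictScalars K) :=
    Submodule.finiteDimensional_inf_left _ _
  have hle := Submodule.finrank_mono (inf_le_inf_left (homogeneousSubmodule σ K n)
    (show I.restrictScalars K ≤ J.restrictScalars K from hIJ))
  have hI := finrank_quotientComponent_add I n
  have hJ := finrank_quotientComponent_add J n
  omega

theorem homogeneousComponent_linearCombination [Fintype ι] {g : ι → MvPolynomial σ K} {a : ι → ℕ}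
    (hg : ∀ i, (g i).IsHomogeneous (a i)) (n : ℕ) (v : ι → MvPolynomial σ K) :
    homogeneousComponent n (Fintype.linearCombination (MvPolynomial σ K) g v) =
      Fintype.linearCombination (MvPolynomial σ K) g (homogeneousProj σ K a n v) := by
  simp only [Fintype.linearCombination_apply, map_sum, smul_eq_mul, homogeneousProj_apply,
    homogeneousComponent_mul_of_isHomogeneous _ (hg _), ite_mul, zero_mul]

theorem finrank_quotientComponent_span_range_add [Finite σ] [Fintype ι]
    {g : ι → MvPolynomial σ K} {a : ι → ℕ} (hg : ∀ i, (g i).IsHomogeneous (a i)) (n : ℕ) :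
    Module.finrank K (quotientComponent (Ideal.span (Set.range g)) n) +
        Module.finrank K ((homogeneousPart σ K a n).map
          ((Fintype.linearCombination (MvPolynomial σ K) g).restrictScalars K)) =
      Module.finrank K (homogeneousSubmodule σ K n) := by
  set T := (Fintype.linearCombination (MvPolynomial σ K) g).restrictScalars K with hT
  have hrange : LinearMap.range T = (Ideal.span (Set.range g)).restrictScalars K := by
    rw [hT, LinearMap.range_restrictScalars, Fintype.range_linearCombination, Ideal.span]
  have hcomm : ∀ v, homogeneousComponent n (T v) = T (homogeneousProj σ K a n v) := fun v => by
    rw [hT, LinearMap.restrictScalars_apply, LinearMap.restrictScalars_apply,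
      homogeneousComponent_linearCombination hg]
  rw [map_eq_inf_range_of_isProj (isProj_homogeneousProj a n) (isProj_homogeneousComponent n) hcomm,
    hrange, finrank_quotientComponent_add]

theorem finrank_quotientComponent_add_of_exact [Finite σ] [Fintype ι] [Finite κ] [DecidableEq κ]
    {g : ι → MvPolynomial σ K} {a : ι → ℕ} {b : κ → ℕ} (hg : ∀ i, (g i).IsHomogeneous (a i))
    {φ : (κ → MvPolynomial σ K) →ₗ[MvPolynomial σ K] (ι → MvPolynomial σ K)}
    (hφ : ∀ j, φ (Pi.single j 1) ∈ homogeneousPart σ K a (b j))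
    (hex : Function.Exact φ (Fintype.linearCombination (MvPolynomial σ K) g)) (n : ℕ) :
    Module.finrank K (quotientComponent (Ideal.span (Set.range g)) n) +
        Module.finrank K (homogeneousPart σ K a n) =
      Module.finrank K (homogeneousSubmodule σ K n) +
        Module.finrank K ((homogeneousPart σ K b n).map (φ.restrictScalars K)) := by
  rw [finrank_homogeneousPart_eq_of_exact hφ hex n, ← add_assoc,
    finrank_quotientComponent_span_range_add hg]

end HilbertFunctions

section PartialDerivatives

theorem eq_C_of_pderiv_eq_zero {σ R : Type*} [CommRing R] [IsDomain R] [CharZero R]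
    {p : MvPolynomial σ R} (h : ∀ i, pderiv i p = 0) : p = C (constantCoeff p) := by
  classical
  ext m
  rw [coeff_C]
  split_ifs with hm
  · rw [← hm, constantCoeff_eq]
  · obtain ⟨i, hi⟩ : ∃ i, m i ≠ 0 := by
      by_contra! hc
      exact hm (Finsupp.ext hc).symm
    have hcoeff := coeff_pderiv (i := i) p (m - Finsupp.single i 1)
    rw [h i, coeff_zero, tsub_add_cancel_of_le
      (by simpa using Nat.one_le_iff_ne_zero.mpr hi)] at hcoeff
    exact (mul_eq_zero.mp hcoeff.symm).resolve_right (Nat.cast_add_one_ne_zero _)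

theorem totalDegree_pderiv_lt {σ R : Type*} [CommSemiring R] {p : MvPolynomial σ R} {i : σ}
    (h : pderiv i p ≠ 0) : (pderiv i p).totalDegree < p.totalDegree := by
  obtain ⟨m, hm, hdeg⟩ := Finset.exists_mem_eq_sup (pderiv i p).support
    (support_nonempty.mpr h) fun s => s.degree
  have hmem : m + Finsupp.single i 1 ∈ p.support := by
    rw [mem_support_iff] at hm ⊢
    rw [coeff_pderiv] at hm
    exact left_ne_zero_of_mul hm
  calc (pderiv i p).totalDegree = m.degree := hdeg
    _ < m.degree + 1 := Nat.lt_succ_self _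
    _ = (m + Finsupp.single i 1).degree := by rw [map_add, Finsupp.degree_single]
    _ ≤ p.totalDegree := le_totalDegree hmem

variable {σ K : Type*} [Field K] [CharZero K]

theorem exists_not_dvd_pderiv_of_irreducible {p : MvPolynomial σ K} (hp : Irreducible p) :
    ∃ i, ¬ p ∣ pderiv i p := by
  obtain ⟨i, hi⟩ : ∃ i, pderiv i p ≠ 0 := by
    by_contra! h
    have hC := eq_C_of_pderiv_eq_zero h
    have h0 : constantCoeff p ≠ 0 := fun h0 => hp.ne_zero (by rw [hC, h0, C_0])
    exact hp.not_isUnit (hC ▸ h0.isUnit.map C)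
  refine ⟨i, fun hdvd => (totalDegree_pderiv_lt hi).not_ge ?_⟩
  obtain ⟨q, hq⟩ := hdvd
  rw [hq, totalDegree_mul_of_isDomain hp.ne_zero (right_ne_zero_of_mul (hq ▸ hi))]
  exact Nat.le_add_right _ _

theorem exists_not_dvd_pderiv_of_squarefree [Finite σ] {f p : MvPolynomial σ K} {d : ℕ}
    (hd : d ≠ 0) (hf : f.IsHomogeneous d) (hsq : Squarefree f) (hp : Irreducible p) :
    ∃ i, ¬ p ∣ pderiv i f := by
  cases nonempty_fintype σ
  by_contra! h
  have hpf : p ∣ f := by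
    have heuler : p ∣ d • f := by
      rw [← hf.sum_X_mul_pderiv]
      exact Finset.dvd_sum fun i _ => (h i).mul_left _
    have hunit : IsUnit (d : MvPolynomial σ K) := by
      rw [← map_natCast (C : K →+* MvPolynomial σ K)]
      exact (Nat.cast_ne_zero.mpr hd).isUnit.map C
    rwa [nsmul_eq_mul, hunit.dvd_mul_left] at heuler
  obtain ⟨g, rfl⟩ := hpf
  obtain ⟨i, hi⟩ := exists_not_dvd_pderiv_of_irreducible hp
  have hpg : p ∣ g := by
    have hdvd := h i
    rw [pderiv_mul, dvd_add_left (dvd_mul_right p _)] at hdvd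
    exact (hp.prime.dvd_or_dvd hdvd).resolve_left hi
  exact hp.not_isUnit (hsq p (mul_dvd_mul_left p hpg))

end PartialDerivatives

section CoprimeForms

theorem subsingleton_setOf_dvd_add_C_mul {σ K : Type*} [Field K] {p a b : MvPolynomial σ K}
    (h : p ∣ a → ¬ p ∣ b) : {c : K | p ∣ a + C c * b}.Subsingleton := by
  intro c hc c' hc'
  by_contra hne
  have hunit : IsUnit (C (c - c') : MvPolynomial σ K) :=
    (sub_ne_zero.mpr hne).isUnit.map C
  have hb : p ∣ b := by
    rw [← hunit.dvd_mul_left, C_sub, sub_mul, ← add_sub_add_left_eq_sub _ _ a]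
    exact dvd_sub hc hc'
  exact h ((dvd_add_left (hb.mul_left _)).mp hc) hb

theorem exists_isRelPrime_add_C_mul {σ K : Type*} [Field K] [Infinite K]
    {g a b : MvPolynomial σ K} (hg : g ≠ 0)
    (h : ∀ p, Irreducible p → p ∣ g → p ∣ a → ¬ p ∣ b) : ∃ c : K, IsRelPrime g (a + C c * b) := by
  classical
  have hbad : (⋃ p ∈ (UniqueFactorizationMonoid.factors g).toFinset,
      {c : K | p ∣ a + C c * b}).Finite :=
    Set.Finite.biUnion (Finset.finite_toSet _) fun p hp => by
      rw [Finset.mem_coe, Multiset.mem_toFinset] at hp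
      exact (subsingleton_setOf_dvd_add_C_mul
        (h p (UniqueFactorizationMonoid.irreducible_of_factor p hp)
          (UniqueFactorizationMonoid.dvd_of_mem_factors hp))).finite
  obtain ⟨c, hc⟩ := hbad.exists_notMem
  refine ⟨c, WfDvdMonoid.isRelPrime_of_no_irreducible_factors (fun h0 => hg h0.1) ?_⟩
  intro p hp hpg hpc
  obtain ⟨q, hq, hassoc⟩ := UniqueFactorizationMonoid.exists_mem_factors_of_dvd hg hp hpg
  exact hc (Set.mem_biUnion (Multiset.mem_toFinset.mpr hq) (hassoc.symm.dvd.trans hpc))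

theorem exact_of_isRelPrime {R : Type*} [CommRing R] [IsDomain R] [DecompositionMonoid R]
    {g h : R} (hg : g ≠ 0) (hgh : IsRelPrime g h) :
    Function.Exact (Fintype.linearCombination R fun _ : Fin 1 => ![h, -g])
      (Fintype.linearCombination R ![g, h]) := by
  intro v
  simp only [Fintype.linearCombination_apply, Fin.sum_univ_two, Set.mem_range,
    Matrix.cons_val_zero, Matrix.cons_val_one, smul_eq_mul, Fin.sum_univ_one]
  constructor
  · intro hv
    obtain ⟨c, hc⟩ : g ∣ v 1 := hgh.dvd_of_dvd_mul_right ⟨-v 0, by linear_combination hv⟩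
    have h0 : v 0 = -c * h := mul_left_cancel₀ hg (by rw [hc] at hv; linear_combination hv)
    refine ⟨fun _ => -c, funext (Fin.forall_fin_two.mpr ⟨?_, ?_⟩)⟩
    · simp [h0]
    · simp [hc, mul_comm]
  · rintro ⟨w, rfl⟩
    simp only [Pi.smul_apply, Matrix.cons_val_zero, Matrix.cons_val_one, smul_eq_mul]
    ring

theorem injective_linearCombination_of_ne_zero {R ι : Type*} [CommRing R] [IsDomain R]
    {v : ι → R} (hv : v ≠ 0) :
    Function.Injective (Fintype.linearCombination R fun _ : Fin 1 => v) :=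
  linearIndependent_iff_injective_fintypeLinearCombination.mp
    (LinearIndependent.of_subsingleton 0 hv)

theorem finrank_quotientComponent_of_isRelPrime {K : Type*} [Field K]
    {g h : MvPolynomial (Fin 3) K} {a b n : ℕ} (hg : g.IsHomogeneous a) (hh : h.IsHomogeneous b)
    (hg0 : g ≠ 0) (hgh : IsRelPrime g h) (hn : a + b ≤ n) :
    Module.finrank K (quotientComponent (Ideal.span (Set.range ![g, h])) n) = a * b := by
  have hgen : ∀ i, (![g, h] i).IsHomogeneous (![a, b] i) := Fin.forall_fin_two.mpr ⟨hg, hh⟩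
  have hφ : ∀ j, Fintype.linearCombination (MvPolynomial (Fin 3) K) (fun _ : Fin 1 => ![h, -g])
      (Pi.single j 1) ∈ homogeneousPart (Fin 3) K ![a, b] (a + b) := fun j => by
    rw [Fintype.linearCombination_apply_single, one_smul, mem_homogeneousPart]
    exact Fin.forall_fin_two.mpr ⟨Or.inl ⟨Nat.le_add_right _ _, by simpa using hh⟩,
      Or.inl ⟨Nat.le_add_left _ _, by simpa using hg.neg⟩⟩
  have hinj := injective_linearCombination_of_ne_zero (v := ![h, -g])
    fun h0 => hg0 (neg_eq_zero.mp (congrFun h0 1))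
  have hkoszul := finrank_quotientComponent_add_of_exact (b := fun _ => a + b) hgen hφ
    (exact_of_isRelPrime hg0 hgh) n
  rw [finrank_map_of_injective hinj, ← Nat.cast_inj (R := ℚ), Nat.cast_add, Nat.cast_add,
    finrank_homogeneousPart fun _ => hn,
    finrank_homogeneousPart (Fin.forall_fin_two.mpr ⟨by simp; omega, by simp; omega⟩),
    finrank_homogeneousSubmodule_fin_three] at hkoszul
  simp only [Fin.sum_univ_two, Matrix.cons_val_zero, Matrix.cons_val_one, Finset.sum_const,
    Finset.card_univ, Fintype.card_fin, one_nsmul, Nat.cast_add] at hkoszul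
  rw [← Nat.cast_inj (R := ℚ), Nat.cast_mul]
  linear_combination hkoszul

theorem exists_isRelPrime_pderiv {K : Type*} [Field K] [CharZero K]
    {f : MvPolynomial (Fin 3) K} {d : ℕ} (hd : d ≠ 0) (hf : f.IsHomogeneous d)
    (hsq : Squarefree f) {i : Fin 3} (hi : pderiv i f ≠ 0) :
    ∃ c : K, IsRelPrime (pderiv i f) (pderiv (i + 1) f + C c * pderiv (i + 2) f) := by
  refine exists_isRelPrime_add_C_mul hi fun p hp h₀ h₁ h₂ => ?_
  obtain ⟨j, hj⟩ := exists_not_dvd_pderiv_of_squarefree hd hf hsq hp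
  have hcases : ∀ i j : Fin 3, j = i ∨ j = i + 1 ∨ j = i + 2 := by decide
  rcases hcases i j with rfl | rfl | rfl
  exacts [hj h₀, hj h₁, hj h₂]

theorem finrank_milnorComponent_le {f : S} {d n : ℕ} (hd : d ≠ 0) (hf : f.IsHomogeneous d)
    (hsq : Squarefree f) (hn : 2 * (d - 1) ≤ n) :
    Module.finrank ℂ (milnorComponent f n) ≤ (d - 1) ^ 2 := by
  obtain ⟨i, hi⟩ := exists_pderiv_ne_zero hd hf hsq.ne_zero
  obtain ⟨c, hc⟩ := exists_isRelPrime_pderiv hd hf hsq hi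
  have hmem : ∀ i, pderiv i f ∈ jacobianIdeal f := fun i => Ideal.subset_span ⟨i, rfl⟩
  have hle : Ideal.span (Set.range ![pderiv i f, pderiv (i + 1) f + C c * pderiv (i + 2) f]) ≤
      jacobianIdeal f := by
    rw [Ideal.span_le, Set.range_subset_iff]
    exact Fin.forall_fin_two.mpr
      ⟨hmem i, add_mem (hmem _) (Ideal.mul_mem_left _ _ (hmem _))⟩
  calc Module.finrank ℂ (milnorComponent f n)
      = Module.finrank ℂ (quotientComponent (jacobianIdeal f) n) := rfl
    _ ≤ Module.finrank ℂ (quotientComponent (Ideal.span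
          (Set.range ![pderiv i f, pderiv (i + 1) f + C c * pderiv (i + 2) f])) n) :=
        finrank_quotientComponent_anti hle n
    _ = (d - 1) ^ 2 := by
      rw [finrank_quotientComponent_of_isRelPrime hf.pderiv (hf.pderiv.add (hf.pderiv.C_mul c)) hi
        hc (by omega), sq]

end CoprimeForms

section Numerics

theorem sum_sub_add_one_mul_sub_add_two {ι : Type*} [Fintype ι] (a : ι → ℚ) (n : ℚ) :
    ∑ i, (n - a i + 1) * (n - a i + 2) / 2 =
      Fintype.card ι * ((n + 1) * (n + 2) / 2) - (n + 3 / 2) * ∑ i, a i + (∑ i, a i ^ 2) / 2 := by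
  rw [← Finset.card_univ, ← nsmul_eq_mul, ← Finset.sum_const, Finset.mul_sum, Finset.sum_div,
    ← Finset.sum_sub_distrib, ← Finset.sum_add_distrib]
  exact Finset.sum_congr rfl fun i _ => by ring

theorem eq_zero_of_eventually_bounded {A B M : ℚ}
    (h : ∀ᶠ n : ℕ in Filter.atTop, 0 ≤ A * n + B ∧ A * n + B ≤ M) : A = 0 := by
  rcases lt_trichotomy A 0 with hA | hA | hA
  · obtain ⟨n, hn, hnonneg, _⟩ :=
      ((tendsto_natCast_atTop_atTop.eventually_gt_atTop (B / -A)).and h).exists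
    rw [div_lt_iff₀ (by linarith)] at hn
    linarith
  · exact hA
  · obtain ⟨n, hn, _, hle⟩ :=
      ((tendsto_natCast_atTop_atTop.eventually_gt_atTop ((M - B) / A)).and h).exists
    rw [div_lt_iff₀ hA] at hn
    linarith

theorem eq_ite_of_monotone_of_sum_eq_one {k : ℕ} {t : Fin k → ℕ} (ht : Monotone t)
    (hsum : ∑ i, t i = 1) (j : Fin k) : t j = if (j : ℕ) + 1 = k then 1 else 0 := by
  obtain _ | k := k
  · exact j.elim0
  rw [Fin.sum_univ_castSucc] at hsum
  have hlast : t (Fin.last k) ≠ 0 := fun h0 => by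
    have hinit : ∑ i : Fin k, t i.castSucc = 0 :=
      Finset.sum_eq_zero fun i _ => Nat.le_zero.mp (h0 ▸ ht (Fin.le_last _))
    omega
  have hinit : ∑ i : Fin k, t i.castSucc = 0 := by omega
  induction j using Fin.lastCases with
  | last => rw [Fin.val_last, if_pos rfl]; omega
  | cast i =>
    rw [Finset.sum_eq_zero_iff.mp hinit i (Finset.mem_univ i), if_neg]
    simp only [Fin.val_castSucc, Nat.add_right_cancel_iff, i.2.ne, not_false_eq_true]

end Numerics

namespace MinimalResolution

variable {f : S} {d r : ℕ} (R : MinimalResolution f d)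

theorem finrank_milnorComponent_add (hf : f.IsHomogeneous d) (n : ℕ) :
    Module.finrank ℂ (milnorComponent f n) +
        Module.finrank ℂ (homogeneousPart (Fin 3) ℂ (fun _ : Fin 3 => d - 1) n) +
        Module.finrank ℂ (homogeneousPart (Fin 3) ℂ R.e n) =
      Module.finrank ℂ (homogeneousSubmodule (Fin 3) ℂ n) +
        Module.finrank ℂ (homogeneousPart (Fin 3) ℂ (fun j => d - 1 + R.deg j) n) := by
  have hquot : Module.finrank ℂ (milnorComponent f n) +
      Module.finrank ℂ (homogeneousPart (Fin 3) ℂ (fun _ : Fin 3 => d - 1) n) = _ :=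
    finrank_quotientComponent_add_of_exact (fun _ => hf.pderiv) (isGradedMap_iff.mp R.graded₂)
      R.exact₁ n
  rw [hquot, finrank_homogeneousPart_eq_of_exact (isGradedMap_iff.mp R.graded₃) R.exact₂,
    finrank_map_of_injective (φ := R.φ₃.restrictScalars ℂ) R.injective₃, add_assoc]

theorem eventually_finrank_milnorComponent_eq (hf : f.IsHomogeneous d) :
    ∀ᶠ n : ℕ in Filter.atTop, (Module.finrank ℂ (milnorComponent f n) : ℚ) =
      (∑ i, (R.e i : ℚ) + 3 * (d - 1 : ℕ) - ∑ j, ((d - 1 + R.deg j : ℕ) : ℚ)) * (n + 3 / 2) +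
        (∑ j, ((d - 1 + R.deg j : ℕ) : ℚ) ^ 2 - 3 * (d - 1 : ℕ) ^ 2 -
          ∑ i, (R.e i : ℚ) ^ 2) / 2 := by
  filter_upwards [Filter.eventually_ge_atTop (d - 1),
    Filter.eventually_all.mpr fun j => Filter.eventually_ge_atTop (d - 1 + R.deg j),
    Filter.eventually_all.mpr fun i => Filter.eventually_ge_atTop (R.e i)] with n hn hdeg he
  have hadd := congrArg (Nat.cast (R := ℚ)) (R.finrank_milnorComponent_add hf n)
  push_cast only [Nat.cast_add] at hadd
  rw [finrank_homogeneousPart fun _ => hn, finrank_homogeneousPart hdeg, finrank_homogeneousPart he,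
    finrank_homogeneousSubmodule_fin_three] at hadd
  simp only [sum_sub_add_one_mul_sub_add_two, Finset.sum_const, Finset.card_univ,
    Fintype.card_fin, nsmul_eq_mul] at hadd
  push_cast at hadd ⊢
  linear_combination hadd

theorem sum_e_add_eq (hd : d ≠ 0) (hf : f.IsHomogeneous d) (hsq : Squarefree f) :
    ∑ i, R.e i + 3 * (d - 1) = ∑ j, (d - 1 + R.deg j) := by
  have hlin := R.eventually_finrank_milnorComponent_eq hf
  simp only [mul_add, add_assoc] at hlin
  have hslope := eq_zero_of_eventually_bounded (M := ((d - 1) ^ 2 : ℕ))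
    ((hlin.and (Filter.eventually_ge_atTop (2 * (d - 1)))).mono fun n ⟨hn, hle⟩ =>
      ⟨(Nat.cast_nonneg _).trans_eq hn,
        hn.symm.trans_le (Nat.cast_le.mpr (finrank_milnorComponent_le hd hf hsq hle))⟩)
  exact_mod_cast sub_eq_zero.mp hslope

theorem exists_lt_e (i : Fin R.k) : ∃ j, d - 1 + R.deg j < R.e i := by
  have hne : R.φ₃ (Pi.single i 1) ≠ 0 := fun h =>
    one_ne_zero (Pi.single_eq_zero_iff.mp (R.injective₃ (h.trans (map_zero _).symm)))
  obtain ⟨j, hj⟩ := Function.ne_iff.mp hne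
  obtain ⟨hle, hhom⟩ := (R.graded₃ i j).resolve_right hj
  refine ⟨j, lt_of_le_of_ne hle fun heq => hj ?_⟩
  simp only [heq, Nat.sub_self] at hhom
  rw [← totalDegree_zero_iff_isHomogeneous, totalDegree_eq_zero_iff_eq_C,
    ← constantCoeff_eq, R.minimal₃, C_0] at hhom
  exact hhom

theorem sum_e_sub_eq (hd : d ≠ 0) (hf : f.IsHomogeneous d) (hsq : Squarefree f)
    (hdeg : ∀ j, R.deg j = r) :
    ∑ i, ((R.e i : ℤ) - (d + r)) = 2 * r - d + 1 - R.k := by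
  have htotal := congrArg (Nat.cast (R := ℤ)) (R.sum_e_add_eq hd hf hsq)
  simp only [hdeg, Finset.sum_const, Finset.card_univ, Fintype.card_fin, smul_eq_mul] at htotal
  push_cast [Nat.cast_sub (Nat.one_le_iff_ne_zero.mpr hd)] at htotal
  simp only [Finset.sum_sub_distrib, Finset.sum_const, Finset.card_univ, Fintype.card_fin,
    nsmul_eq_mul]
  linear_combination htotal

theorem e_eq (hd : d ≠ 0) (hf : f.IsHomogeneous d) (hsq : Squarefree f)
    (hdeg : ∀ j, R.deg j = r) (hk : R.k + d = 2 * r) (j : Fin R.k) :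
    R.e j = d + r + if (j : ℕ) + 1 = R.k then 1 else 0 := by
  have hle : ∀ i, d + r ≤ R.e i := fun i => by
    obtain ⟨j, hj⟩ := R.exists_lt_e i
    have := hdeg j
    omega
  have hsum : ∑ i, (R.e i - (d + r)) = 1 := by
    have hsub := R.sum_e_sub_eq hd hf hsq hdeg
    rw [← Nat.cast_inj (R := ℤ), Nat.cast_sum]
    push_cast [Nat.cast_sub (hle _)]
    omega
  rw [← eq_ite_of_monotone_of_sum_eq_one
    (fun i i' h => Nat.sub_le_sub_right (R.e_mono h) (d + r)) hsum j, Nat.add_sub_cancel' (hle j)]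

theorem ε_eq (hd : d ≠ 0) (hf : f.IsHomogeneous d) (hsq : Squarefree f)
    (hdeg : ∀ j, R.deg j = r) (hk : R.k + d = 2 * r) (j : Fin R.k) :
    R.ε j = if (j : ℕ) + 1 = R.k then 2 else 1 := by
  rw [ε, R.e_eq hd hf hsq hdeg hk j, hdeg]
  split_ifs <;> push_cast <;> ring

theorem sum_sq_e_eq (hd : d ≠ 0) (hf : f.IsHomogeneous d) (hsq : Squarefree f)
    (hdeg : ∀ j, R.deg j = r) (hk : R.k + d = 2 * r) :
    ∑ i, (R.e i : ℚ) ^ 2 =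
      (2 * (d + r) + 1) * ∑ i, (R.e i : ℚ) - R.k * ((d + r) * (d + r + 1)) := by
  have hconst : (R.k : ℚ) * ((d + r) * (d + r + 1)) =
      ∑ _i : Fin R.k, ((d : ℚ) + r) * (d + r + 1) := by
    rw [Finset.sum_const, Finset.card_univ, Fintype.card_fin, nsmul_eq_mul]
  rw [Finset.mul_sum, hconst, ← Finset.sum_sub_distrib]
  refine Finset.sum_congr rfl fun i _ => ?_
  rw [R.e_eq hd hf hsq hdeg hk i]
  split_ifs <;> push_cast <;> ring

theorem eventually_finrank_milnorComponent_eq_of_deg_eq (hd : d ≠ 0) (hf : f.IsHomogeneous d)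
    (hsq : Squarefree f) (hdeg : ∀ j, R.deg j = r) (hk : R.k + d = 2 * r) :
    ∀ᶠ n : ℕ in Filter.atTop, (Module.finrank ℂ (milnorComponent f n) : ℚ) =
      (d : ℚ) * (d - 1) / 2 - 1 + r * (d - r - 2) := by
  have htotal := congrArg (Nat.cast (R := ℚ)) (R.sum_e_add_eq hd hf hsq)
  have hkq : (R.k : ℚ) = 2 * r - d := by
    rw [eq_sub_iff_add_eq]
    exact_mod_cast hk
  filter_upwards [R.eventually_finrank_milnorComponent_eq hf] with n hn
  rw [hn, R.sum_sq_e_eq hd hf hsq hdeg hk]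
  simp only [hdeg, Finset.sum_const, Finset.card_univ, Fintype.card_fin, smul_eq_mul,
    nsmul_eq_mul] at htotal ⊢
  push_cast [Nat.cast_sub (Nat.one_le_iff_ne_zero.mpr hd)] at htotal ⊢
  rw [hkq] at htotal ⊢
  linear_combination (n + 3 / 2 - (2 * ((d : ℚ) + r) + 1) / 2) * htotal

theorem exists_isTotalTjurinaNumber (hd : d ≠ 0) (hf : f.IsHomogeneous d) (hsq : Squarefree f)
    (hdeg : ∀ j, R.deg j = r) (hk : R.k + d = 2 * r) :
    ∃ τ : ℕ, IsTotalTjurinaNumber f τ ∧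
      (τ : ℚ) = (d : ℚ) * (d - 1) / 2 - 1 + r * (d - r - 2) := by
  have hτ := R.eventually_finrank_milnorComponent_eq_of_deg_eq hd hf hsq hdeg hk
  obtain ⟨n, hn⟩ := hτ.exists
  refine ⟨_, ?_, hn⟩
  filter_upwards [hτ] with n' hn'
  exact_mod_cast hn'.trans hn.symm

end MinimalResolution

end PlaneCurve

theorem mainTheorem2_general (f : PlaneCurve.S) (d r m : ℕ) (hC : PlaneCurve.IsCurveOfType f d r m)
    (hΔ : (2 * r - d + 3 - m : ℤ) = 1) :
    Nonempty (PlaneCurve.MinimalResolution f d) ∧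
    (∀ R : PlaneCurve.MinimalResolution f d,
      R.k + 2 = m ∧ (∀ j, R.deg j = r) ∧
      (∀ j : Fin R.k, (j : ℕ) + 1 = R.k → R.ε j = 2) ∧
      (∀ j : Fin R.k, (j : ℕ) + 1 < R.k → R.ε j = 1)) ∧
    ∃ τ : ℕ, PlaneCurve.IsTotalTjurinaNumber f τ ∧
      (τ : ℚ) = (d : ℚ) * (d - 1) / 2 - 1 + r * (d - r - 2) := by
  obtain ⟨hd, hf, hsq, ρ, hρ⟩ := hC
  have hd0 : d ≠ 0 := by omega
  have hbetti (R : PlaneCurve.MinimalResolution f d) :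
      R.k + 2 = m ∧ R.k + d = 2 * r ∧ ∀ j, R.deg j = r := by
    have hk := R.k_add_two_eq hρ
    exact ⟨hk, by omega, fun j => (R.exists_deg_eq hρ j).elim fun _ h => h.symm⟩
  obtain ⟨R₀⟩ := PlaneCurve.nonempty_minimalResolution (by omega) hf hsq.ne_zero (by omega) hρ
  refine ⟨⟨R₀⟩, fun R => ?_, ?_⟩
  · obtain ⟨hm, hk, hdeg⟩ := hbetti R
    have hε := R.ε_eq hd0 hf hsq hdeg hk
    exact ⟨hm, hdeg, fun j hj => (hε j).trans (if_pos hj),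
      fun j hj => (hε j).trans (if_neg hj.ne)⟩
  · obtain ⟨-, hk, hdeg⟩ := hbetti R₀
    exact R₀.exists_isTotalTjurinaNumber hd0 hf hsq hdeg hk

theorem mainTheorem2 (f : PlaneCurve.S) (d r m : ℕ) (hC : PlaneCurve.IsCurveOfType f d r m)
    (hm : 3 < m) (hΔ : (2 * r - d + 3 - m : ℤ) = 1) :
    Nonempty (PlaneCurve.MinimalResolution f d) ∧
    (∀ R : PlaneCurve.MinimalResolution f d,
      R.k + 2 = m ∧ (∀ j, R.deg j = r) ∧
      (∀ j : Fin R.k, (j : ℕ) + 1 = R.k → R.ε j = 2) ∧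
      (∀ j : Fin R.k, (j : ℕ) + 1 < R.k → R.ε j = 1)) ∧
    ∃ τ : ℕ, PlaneCurve.IsTotalTjurinaNumber f τ ∧
      (τ : ℚ) = (d : ℚ) * (d - 1) / 2 - 1 + r * (d - r - 2) :=
  mainTheorem2_general f d r m hC hΔ
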